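/- Let $\mathcal{X}$, $\mathcal{Y}$ be sets. An asymmetric hash for $\mathcal{X},\mathcal{Y}$ is a joint probability distribution over pairs of mappings $(f,g)$, $f:\mathcal{X}\to\Gamma$, $g:\mathcal{Y}\to\Gamma$, into some alphabet $\Gamma$ (for which every collision event $\{f(x)=g(y)\}$ is measurable). For $S>0$ and $0<c<1$, and a similarity function $\mathrm{sim}:\mathcal{X}\times\mathcal{Y}\to\mathbb{R}$, such a hash is an $(S,cS)$-ALSH (asymmetric locality sensitive hash) for $\mathrm{sim}$ over $\mathcal{X},\mathcal{Y}$ if there exist real numbers $p_1>p_2$ such that for all $x\in\mathcal{X}$ and $y\in\mathcal{Y}$: - if $\mathrm{sim}(x,y)\ge S$, then $\mathbb{P}_{(f,g)}[f(x)=g(y)]\ge p_1$; - if $\mathrm{sim}(x,y)\le cS$, then $\mathbb{P}_{(f,g)}[f(x)=g(y)]\le p_2$. **Theorem.** For any integer $d\ge 2$, any $S>0$ and any $0<c<1$, and for any alphabet $\Gamma$, there is no asymmetric hash that is an $(S,cS)$-ALSH for the inner product similarity $\mathrm{sim}(x,y)=x^\top y$ over $\mathcal{X}=\mathcal{Y}=\mathbb{R}^d$.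 -/

import Mathlib

open MeasureTheory

/-- An asymmetric hash for a pair of spaces `X`, `Y` with alphabet `Γ`: a joint probability
distribution over pairs of mappings `(f, g)`, `f : X → Γ`, `g : Y → Γ`. The only requirement on the
σ-algebra on which the distribution lives is that the collision events `{f x = g y}` are
measurable, so that the collision probabilities are defined. -/
structure AsymmetricHash (X Y Γ : Type*) where
  [measurableSpace : MeasurableSpace ((X → Γ) × (Y → Γ))]
  law : Measure ((X → Γ) × (Y → Γ))
  isProbabilityMeasure : IsProbabilityMeasure law
  measurableSet_collision :
    ∀ (x : X) (y : Y), MeasurableSet {fg : (X → Γ) × (Y → Γ) | fg.1 x = fg.2 y}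

namespace AsymmetricHash

variable {X Y Γ : Type*}

/-- The collision probability `ℙ_{(f, g)}[f x = g y]`. -/
noncomputable def collisionProb (H : AsymmetricHash X Y Γ) (x : X) (y : Y) : ℝ :=
  letI := H.measurableSpace
  H.law.real {fg : (X → Γ) × (Y → Γ) | fg.1 x = fg.2 y}

/-- The hash is an `(S, cS, p₁, p₂)`-ALSH for the similarity function `sim` over `X`, `Y`. -/
def IsALSHWith (H : AsymmetricHash X Y Γ) (sim : X → Y → ℝ) (S c p₁ p₂ : ℝ) : Prop :=
  ∀ (x : X) (y : Y),
    (S ≤ sim x y → p₁ ≤ H.collisionProb x y) ∧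
    (sim x y ≤ c * S → H.collisionProb x y ≤ p₂)

/-- The hash is an `(S, cS)`-ALSH for the similarity function `sim` over `X`, `Y`. -/
def IsALSH (H : AsymmetricHash X Y Γ) (sim : X → Y → ℝ) (S c : ℝ) : Prop :=
  ∃ p₁ p₂ : ℝ, p₂ < p₁ ∧ H.IsALSHWith sim S c p₁ p₂

end AsymmetricHash

open MeasureTheory Filter Topology

/-! Points of the plane realise a triangular pattern of similarities, so an ALSH would have
collision probabilities at least `p₁` for `i ≤ j` and at most `p₂ < p₁` for `j < i`. Such a matrix
is the Gram matrix of bounded vectors in an `L²` space: indicators of pairs (label, outcome). Weak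
limits `a`, `b` of the two families make `⟪a, b⟫` the iterated limit in either order, hence both at
least `p₁` and at most `p₂`. -/

/-- A bounded sequence in a real Hilbert space converges weakly along every ultrafilter. -/
theorem exists_tendsto_inner_of_bounded {E : Type*} [NormedAddCommGroup E]
    [InnerProductSpace ℝ E] [CompleteSpace E] (U : Ultrafilter ℕ) (u : ℕ → E) (C : ℝ)
    (hu : ∀ i, ‖u i‖ ≤ C) :
    ∃ a : E, ∀ w : E, Tendsto (fun i => inner ℝ (u i) w) U (𝓝 (inner ℝ a w)) := by
  let φ : ℕ → WeakDual ℝ E := fun i => StrongDual.toWeakDual (InnerProductSpace.toDual ℝ E (u i))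
  -- Banach–Alaoglu, carried back to `E` by Riesz representation.
  have hK := WeakDual.isCompact_closedBall (𝕜 := ℝ) (E := E) 0 C
  obtain ⟨ψ, -, hψ⟩ := hK.ultrafilter_le_nhds' (U.map φ) (by
    refine Ultrafilter.mem_map.2 (Filter.Eventually.of_forall fun i => ?_)
    change InnerProductSpace.toDual ℝ E (u i) ∈ Metric.closedBall 0 C
    simpa using hu i)
  refine ⟨(InnerProductSpace.toDual ℝ E).symm (WeakDual.toStrongDual ψ), fun w => ?_⟩
  have h : Tendsto φ U (𝓝 ψ) := hψ
  have h' := ((WeakDual.eval_continuous w).tendsto ψ).comp h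
  rw [InnerProductSpace.toDual_symm_apply]
  exact h'

/-- Bounded sequences in a Hilbert space cannot have a Gram matrix which is uniformly larger on
and above the diagonal than below it. -/
theorem not_bounded_of_triangular_inner {E : Type*} [NormedAddCommGroup E]
    [InnerProductSpace ℝ E] [CompleteSpace E] {u v : ℕ → E} {C p q : ℝ}
    (hu : ∀ i, ‖u i‖ ≤ C) (hv : ∀ i, ‖v i‖ ≤ C) (hpq : q < p)
    (hp : ∀ i j, i ≤ j → p ≤ inner ℝ (u i) (v j))
    (hq : ∀ i j, j < i → inner ℝ (u i) (v j) ≤ q) : False := by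
  let U : Ultrafilter ℕ := hyperfilter ℕ
  have hU : (U : Filter ℕ) ≤ atTop := Nat.hyperfilter_le_atTop
  obtain ⟨a, ha⟩ := exists_tendsto_inner_of_bounded U u C hu
  obtain ⟨b, hb⟩ := exists_tendsto_inner_of_bounded U v C hv
  have h1 : p ≤ inner ℝ a b := by
    -- Here `j` tends to infinity before `i`, so only entries with `i ≤ j` matter; the bound by `q`
    -- takes the opposite order.
    refine ge_of_tendsto (ha b) (Eventually.of_forall fun i => ?_)
    rw [real_inner_comm]
    refine ge_of_tendsto (hb (u i)) (hU ?_)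
    filter_upwards [eventually_ge_atTop i] with j hj
    rw [real_inner_comm]
    exact hp i j hj
  have h2 : inner ℝ a b ≤ q := by
    rw [real_inner_comm]
    refine le_of_tendsto (hb a) (Eventually.of_forall fun j => ?_)
    rw [real_inner_comm]
    refine le_of_tendsto (ha (v j)) (hU ?_)
    filter_upwards [eventually_gt_atTop j] with i hi
    exact hq i j hi
  linarith

/-- Two sequences of sets of measure at most one cannot have intersections whose measures are
uniformly larger on and above the diagonal than below it. -/
theorem not_triangular_measure_inter {Ω : Type*} [MeasurableSpace Ω] {ν : Measure Ω}
    {A B : ℕ → Set Ω} (hA : ∀ i, MeasurableSet (A i)) (hB : ∀ i, MeasurableSet (B i))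
    (hA1 : ∀ i, ν (A i) ≤ 1) (hB1 : ∀ i, ν (B i) ≤ 1) {p q : ℝ} (hpq : q < p)
    (hp : ∀ i j, i ≤ j → p ≤ ν.real (A i ∩ B j))
    (hq : ∀ i j, j < i → ν.real (A i ∩ B j) ≤ q) : False := by
  have hA' : ∀ i, ν (A i) ≠ ⊤ := fun i => ne_top_of_le_ne_top ENNReal.one_ne_top (hA1 i)
  have hB' : ∀ i, ν (B i) ≠ ⊤ := fun i => ne_top_of_le_ne_top ENNReal.one_ne_top (hB1 i)
  have key : ∀ (D : ℕ → Set Ω) (hD : ∀ i, MeasurableSet (D i)) (hD' : ∀ i, ν (D i) ≠ ⊤),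
      (∀ i, ν (D i) ≤ 1) → ∀ i, ‖indicatorConstLp 2 (hD i) (hD' i) (1 : ℝ)‖ ≤ 1 := by
    intro D hD hD' hD1 i
    rw [norm_indicatorConstLp (by norm_num) (by norm_num), norm_one, one_mul]
    refine Real.rpow_le_one measureReal_nonneg ?_ (by norm_num)
    exact ENNReal.toReal_le_of_le_ofReal zero_le_one (by simpa using hD1 i)
  have hin : ∀ i j, inner ℝ (indicatorConstLp 2 (hA i) (hA' i) (1 : ℝ))
      (indicatorConstLp 2 (hB j) (hB' j) (1 : ℝ)) = ν.real (A i ∩ B j) := by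
    intro i j
    rw [L2.inner_indicatorConstLp_one, setIntegral_indicatorConstLp (hA i) (hB j)]
    simp [Set.inter_comm]
  exact not_bounded_of_triangular_inner (key A hA hA' hA1) (key B hB hB' hB1) hpq
    (fun i j h => (hp i j h).trans_eq (hin i j).symm) (fun i j h => (hin i j).trans_le (hq i j h))

/-- If the slices `{ω | (k, ω) ∈ R}` are pairwise disjoint with union `t`, then `R` has the measure
of `t`. -/
theorem count_prod_apply_of_disjoint_slices {Ω : Type*} [MeasurableSpace Ω] (μ : Measure Ω)
    [SFinite μ] {R : Set (ℕ × Ω)} (hR : MeasurableSet R) {t : Set Ω}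
    (huniq : ∀ k l ω, (k, ω) ∈ R → (l, ω) ∈ R → k = l)
    (ht : ∀ ω, ω ∈ t ↔ ∃ k, (k, ω) ∈ R) : (Measure.count.prod μ) R = μ t := by
  have hs : t = ⋃ k, Prod.mk k ⁻¹' R := by
    ext ω
    simp [ht]
  rw [Measure.prod_apply hR, lintegral_count, hs, measure_iUnion]
  · intro k l hkl
    refine Set.disjoint_left.2 fun ω hk hl => hkl (huniq k l ω hk hl)
  · exact fun k => measurable_prodMk_left hR

/-- The collision events of two sequences of random labels cannot have probabilities uniformly
larger on and above the diagonal than below it. -/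
theorem not_triangular_collision {Ω Γ : Type*} [MeasurableSpace Ω] {μ : Measure Ω}
    [IsProbabilityMeasure μ] {f g : ℕ → Ω → Γ}
    (hmeas : ∀ i j, MeasurableSet {ω | f i ω = g j ω}) {p q : ℝ} (hpq : q < p)
    (hp : ∀ i j, i ≤ j → p ≤ μ.real {ω | f i ω = g j ω})
    (hq : ∀ i j, j < i → μ.real {ω | f i ω = g j ω} ≤ q) : False := by
  -- `Γ` carries no σ-algebra, so a label is coded by the first `k` at which `g k ω` equals it.
  let A : ℕ → Set (ℕ × Ω) := fun i =>
    {z | f i z.2 = g z.1 z.2 ∧ ∀ l < z.1, f i z.2 ≠ g l z.2}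
  -- The code of `g j ω` is read off through some `f i`, since events `g k ω = g j ω` need not be
  -- measurable.
  let B : ℕ → Set (ℕ × Ω) := fun j => {z | ∃ i, f i z.2 = g j z.2 ∧ z ∈ A i}
  have hA : ∀ i, MeasurableSet (A i) := by
    intro i
    have : A i = ⋃ k : ℕ, {k} ×ˢ
        ({ω | f i ω = g k ω} ∩ ⋂ l ∈ Set.Iio k, {ω | f i ω = g l ω}ᶜ) := by
      ext ⟨k, ω⟩
      simp [A]
    rw [this]
    exact MeasurableSet.iUnion fun k => (measurableSet_singleton k).prod
      ((hmeas i k).inter (.biInter (Set.to_countable _) fun l _ => (hmeas i l).compl))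
  have hB : ∀ j, MeasurableSet (B j) := by
    intro j
    have : B j = ⋃ i, (Prod.snd ⁻¹' {ω | f i ω = g j ω}) ∩ A i := by
      ext z
      simp [B]
    rw [this]
    exact MeasurableSet.iUnion fun i => (measurable_snd (hmeas i j)).inter (hA i)
  have huniq : ∀ i i' k l ω, f i ω = f i' ω → (k, ω) ∈ A i → (l, ω) ∈ A i' → k = l := by
    rintro i i' k l ω h ⟨hk, hk'⟩ ⟨hl, hl'⟩
    dsimp only at *
    rcases lt_trichotomy k l with hkl | hkl | hkl
    · exact absurd (h.symm.trans hk) (hl' k hkl)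
    · exact hkl
    · exact absurd (h.trans hl) (hk' l hkl)
  have hex : ∀ i j ω, f i ω = g j ω → ∃ k, (k, ω) ∈ A i := by
    classical
    intro i j ω h
    have hne : ∃ k, f i ω = g k ω := ⟨j, h⟩
    exact ⟨Nat.find hne, Nat.find_spec hne, fun l hl => Nat.find_min hne hl⟩
  have hA1 : ∀ i, (Measure.count.prod μ) (A i) ≤ 1 := fun i =>
    (count_prod_apply_of_disjoint_slices μ (hA i) (t := {ω | ∃ k, (k, ω) ∈ A i})
      (fun k l ω => huniq i i k l ω rfl) fun ω => Iff.rfl).trans_le prob_le_one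
  have hB1 : ∀ j, (Measure.count.prod μ) (B j) ≤ 1 := fun j =>
    (count_prod_apply_of_disjoint_slices μ (hB j) (t := {ω | ∃ k, (k, ω) ∈ B j})
      (by
        rintro k l ω ⟨i, hi, hk⟩ ⟨i', hi', hl⟩
        exact huniq i i' k l ω (hi.trans hi'.symm) hk hl) fun ω => Iff.rfl).trans_le prob_le_one
  have hAB : ∀ i j, (Measure.count.prod μ).real (A i ∩ B j) = μ.real {ω | f i ω = g j ω} := by
    intro i j
    refine congrArg ENNReal.toReal (count_prod_apply_of_disjoint_slices μ ((hA i).inter (hB j))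
      (fun k l ω hk hl => huniq i i k l ω rfl hk.1 hl.1) fun ω => ⟨fun h => ?_, ?_⟩)
    · obtain ⟨k, hk⟩ := hex i j ω h
      exact ⟨k, hk, i, h, hk⟩
    -- A shared code `k` forces `f i ω = g k ω = f i' ω`.
    · rintro ⟨k, hk, i', hi', hk'⟩
      exact hk.1.trans (hk'.1.symm.trans hi')
  exact not_triangular_measure_inter hA hB hA1 hB1 hpq
    (fun i j h => (hp i j h).trans_eq (hAB i j).symm) fun i j h => (hAB i j).trans_le (hq i j h)

/-- Already in the plane there are two sequences of vectors whose inner products are at least `S` on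
and above the diagonal and at most `c * S` below it. -/
theorem exists_triangular_inner {d : ℕ} (hd : 2 ≤ d) {S c : ℝ} (hS : 0 < S) (hc : c < 1) :
    ∃ x y : ℕ → EuclideanSpace ℝ (Fin d),
      (∀ i j, i ≤ j → S ≤ inner ℝ (x i) (y j)) ∧
      ∀ i j, j < i → inner ℝ (x i) (y j) ≤ c * S := by
  obtain ⟨n, rfl⟩ := Nat.exists_eq_add_of_le' hd
  let e : ℝ → ℝ → EuclideanSpace ℝ (Fin (n + 2)) := fun a b =>
    WithLp.toLp 2 (Fin.cons a (Fin.cons b 0))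
  have he : ∀ a b a' b', inner ℝ (e a b) (e a' b') = a * a' + b * b' := by
    intro a b a' b'
    simp [e, PiLp.inner_apply, Fin.sum_univ_succ, mul_comm]
  have hB : 0 < (1 - c) * S := mul_pos (by linarith) hS
  -- The inner product is `(2 - c) * S - (1 - c) * S * 2 ^ (i - j)` with an integer exponent: it
  -- equals `S` at `i = j` and `c * S` at `i = j + 1`, and decreases in `i - j`.
  refine ⟨fun i => e ((2 - c) * S) (-((1 - c) * S) * 2 ^ i), fun j => e 1 (2 ^ j)⁻¹, ?_, ?_⟩
  · intro i j hij
    rw [he]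
    have h : (2 : ℝ) ^ i * (2 ^ j)⁻¹ ≤ 1 := by
      rw [← div_eq_mul_inv, div_le_one (by positivity)]
      exact pow_le_pow_right₀ one_le_two hij
    nlinarith [mul_le_mul_of_nonneg_left h hB.le]
  · intro i j hij
    rw [he]
    have h : 2 ≤ (2 : ℝ) ^ i * (2 ^ j)⁻¹ := by
      rw [← div_eq_mul_inv, le_div_iff₀ (by positivity), ← pow_succ']
      exact pow_le_pow_right₀ one_le_two hij
    nlinarith [mul_le_mul_of_nonneg_left h hB.le]

theorem mainTheorem1 (d : ℕ) (hd : 2 ≤ d) (S c : ℝ) (hS : 0 < S) (hc0 : 0 < c) (hc1 : c < 1)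
    (Γ : Type*) :
    ¬ ∃ H : AsymmetricHash (EuclideanSpace ℝ (Fin d)) (EuclideanSpace ℝ (Fin d)) Γ,
        H.IsALSH (fun x y => inner ℝ x y) S c := by
  rintro ⟨H, p, q, hpq, h⟩
  obtain ⟨x, y, hx, hy⟩ := exists_triangular_inner hd hS hc1
  let := H.measurableSpace
  have := H.isProbabilityMeasure
  exact not_triangular_collision (μ := H.law) (f := fun i fg => fg.1 (x i))
    (g := fun j fg => fg.2 (y j)) (fun i j => H.measurableSet_collision _ _) hpq
    (fun i j hij => (h (x i) (y j)).1 (hx i j hij))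
    fun i j hij => (h (x i) (y j)).2 (hy i j hij)
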